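/- Let $G=(V,E)$ be a finite connected undirected graph (loops are allowed), and let $M=(M_{a,b})_{a,b\in V}$ be a Markov kernel on $V$ that is positive on $G$, i.e. $M_{a,b}>0\iff\{a,b\}\in E$; $M$ is not assumed to be reversible. Let $\rho$ be its invariant distribution and let $\widetilde M_{x,y}=\rho_y M_{y,x}/\rho_x$ be the time-reversal kernel. For a sequence $w=(w_0,w_1,\dots)$ of vertices that visits all of $V$, let $\tau_k=\inf\{j:|\{w_0,\dots,w_j\}|=k\}$ for $1\le k\le |V|$, so that $\tau_{|V|}$ is the cover time; the first-entrance tree of $(w_0,\dots,w_{\tau_{|V|}})$ is the tree rooted at $w_0$ with the directed edges $(w_{\tau_k},w_{\tau_k-1})$, $2\le k\le |V|$. For a rooted spanning tree $(t,r)$ of $G$, let $E(t,r)$ be the set of its edges $e=(e^-,e^+)$ directed towards the root, so that $e^+$ is the parent of $e^-$. Then there is a constant $c>0$, depending only on $G$ and $M$, such that the following holds for every Markov chain $W=(W_n)_{n\ge 0}$ with kernel $M$. The cover time $\tau_{|V|}$ of $W$ is almost surely finite, and: 1. for every rooted spanning tree $(t,r)$ of $G$ with $\mathbb P(W_0=r)>0$,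 $$\mathbb P\big[\mathrm{FirstEntranceTree}(W_0,\dots,W_{\tau_{|V|}})=(t,r)\,\big|\,W_0=r\big]=\frac{c}{\rho_r}\prod_{e\in E(t,r)}\widetilde M_{e^-,e^+};$$ 2. if $W_0$ has law $\rho$, then for every rooted spanning tree $(t,r)$ of $G$, $$\mathbb P\big[\mathrm{FirstEntranceTree}(W_0,\dots,W_{\tau_{|V|}})=(t,r)\big]=c\prod_{e\in E(t,r)}\widetilde M_{e^-,e^+}.$$ -/

import Mathlib

namespace AldousBroder

/-- `M` is a Markov kernel on `V` that is positive on the graph with vertex set `V` and set of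
undirected edges `E` (loops are allowed): `M a b > 0` exactly when `{a, b}` is an edge. -/
structure IsPositiveKernel {V : Type*} [Fintype V] [DecidableEq V]
    (E : Set (Sym2 V)) (M : Matrix V V ℝ) : Prop where
  stochastic : M ∈ Matrix.rowStochastic ℝ V
  pos_iff : ∀ a b, 0 < M a b ↔ s(a, b) ∈ E

/-- `ρ` is an invariant distribution of `M`: a probability vector with `ρ M = ρ`. -/
structure IsInvariantDistribution {V : Type*} [Fintype V]
    (M : Matrix V V ℝ) (ρ : V → ℝ) : Prop where
  mem_stdSimplex : ρ ∈ stdSimplex ℝ V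
  invariant : Matrix.vecMul ρ M = ρ

/-- The time-reversal kernel of `M` with respect to `ρ`. -/
noncomputable def reversal {V : Type*} (M : Matrix V V ℝ) (ρ : V → ℝ) : Matrix V V ℝ :=
  Matrix.of fun x y => ρ y * M y x / ρ x

/-- `W` is, under `P`, a Markov chain with kernel `M` (and an arbitrary initial law). -/
structure IsMarkovChain {V Ω : Type*} [MeasurableSpace Ω]
    (M : Matrix V V ℝ) (P : MeasureTheory.Measure Ω) (W : ℕ → Ω → V) : Prop where
  measurableSet_eq : ∀ n v, MeasurableSet {ω | W n ω = v}
  step : ∀ (n : ℕ) (x : ℕ → V),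
    P.real {ω | ∀ i ≤ n + 1, W i ω = x i}
      = P.real {ω | ∀ i ≤ n, W i ω = x i} * M (x n) (x (n + 1))

/-- A rooted spanning tree `(t, r)` of the graph with set of edges `E`. -/
structure RootedSpanningTree {V : Type*} (E : Set (Sym2 V)) where
  tree : SimpleGraph V
  root : V
  isTree : tree.IsTree
  edgeSet_subset : tree.edgeSet ⊆ E

open Classical in
/-- The edges of `(t, r)` directed towards the root: the pairs `(e⁻, e⁺)` such that `e⁺` is the
parent of `e⁻`, i.e. the neighbour of `e⁻` that is one step closer to the root. -/
noncomputable def RootedSpanningTree.edges {V : Type*} [Fintype V] {E : Set (Sym2 V)}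
    (t : RootedSpanningTree E) : Finset (V × V) :=
  Finset.univ.filter fun e =>
    t.tree.Adj e.1 e.2 ∧ t.tree.dist e.1 t.root = t.tree.dist e.2 t.root + 1

/-- The set `{w 0, …, w j}` of vertices visited up to time `j`. -/
def visited {V : Type*} [DecidableEq V] (w : ℕ → V) (j : ℕ) : Finset V :=
  (Finset.range (j + 1)).image w

/-- The trajectory `w` visits all the vertices, i.e. its cover time is finite. -/
def Covers {V : Type*} [Fintype V] [DecidableEq V] (w : ℕ → V) : Prop :=
  ∃ j, (visited w j).card = Fintype.card V

/-- `visitTime w k` is the first time at which `w` has visited `k` different vertices.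
The cover time is `visitTime w (Fintype.card V)`. -/
noncomputable def visitTime {V : Type*} [DecidableEq V] (w : ℕ → V) (k : ℕ) : ℕ :=
  sInf {j | (visited w j).card = k}

/-- The first-entrance tree of a covering trajectory killed at its cover time, given by its
directed edges `(w (τ k), w (τ k - 1))`, `2 ≤ k ≤ |V|`, and its root `w 0`. It depends only on
`w 0, …, w (τ |V|)`. -/
noncomputable def firstEntranceTree {V : Type*} [Fintype V] [DecidableEq V] (w : ℕ → V) :
    Finset (V × V) × V :=
  ((Finset.Icc 2 (Fintype.card V)).image fun k => (w (visitTime w k), w (visitTime w k - 1)), w 0)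

/-- The event that the chain `W` covers `V` and that the first-entrance tree of `W` killed at its
cover time is the rooted spanning tree `t`. -/
def treeEvent {V Ω : Type*} [Fintype V] [DecidableEq V] {E : Set (Sym2 V)}
    (W : ℕ → Ω → V) (t : RootedSpanningTree E) : Set Ω :=
  {ω | Covers (fun n => W n ω) ∧ firstEntranceTree (fun n => W n ω) = (t.edges, t.root)}

end AldousBroder

/-!
The reason for the formula is a Markov chain on trees run backwards in time. Let
`K = reversal M ρ`. If `w` is shifted back by one step, from `w 1` to `w 0`, its first-entrance tree
gets the new root `w 0` and the edge `(w 1, w 0)`, and loses the edge that used to leave `w 0`. So,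
for the stationary chain, the first-entrance trees seen from decreasing times form a Markov chain
whose root moves according to `K`, and the claim is that its stationary measure is the product of
the weights `K e⁻ e⁺`.

Trees are encoded as maps `g : V → V` all of whose orbits reach the root `r` (`IsRooted g r`), and
the free value `g r` is drawn from `K r`: it is the next position of the root. With this convention
`weight K g = ∏ v, K v (g v)` is a product over all vertices, moving the root amounts to advancing
it to `g r` along the cycle of `g`, which is a bijection (`IsRooted.existsUnique`), and resampling
the value at the new root. This gives the stationarity `sum_rooted_eq` and, as a by-product, the
Markov chain tree theorem `vecMul_rootedWeight`: the total weight of the maps rooted at `s` is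
`C * ρ s`, where `C` is the total weight of all rooted maps; the constant of the theorem is `C⁻¹`.

No two-sided chain, and no uniqueness of the stationary measure on trees, is needed. The
first-entrance tree of `w 0, …, w n` is completed by a random rooted map `g` at the unvisited
vertices (`entranceMap`), where `g` is rooted at `w n` and drawn from the stationary measure. By
stationarity the mass of each completed tree does not depend on `n`
(`rootedAverage_entranceMass_succ`): at `n = 0` it is the weight of the tree, and once all vertices
are visited the completed tree is the first-entrance tree, whatever `g` is. Since the cover time is
almost surely finite, letting `n` tend to infinity gives the result
(`measureReal_firstPred_eq`).

The cover time is finite because the masses of the stationary chain killed at `v` decrease to an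
invariant measure vanishing at `v`, and such a measure is zero (`eq_zero_of_invariant`).
-/

namespace AldousBroder

open MeasureTheory Filter Topology

section map

/-! ### Rooted maps and their weights -/

variable {V : Type*}

/-- Every vertex reaches `r` under iteration of `g`. Off `r`, such a `g` is the parent map of a tree
rooted at `r`; the value `g r` is free, so `g` has a unique cycle and `r` lies on it. -/
def IsRooted (g : V → V) (r : V) : Prop := ∀ v, ∃ n : ℕ, g^[n] v = r

theorem IsRooted.apply {g : V → V} {u : V} (h : IsRooted g u) : IsRooted g (g u) := by
  intro v
  obtain ⟨n, hn⟩ := h v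
  exact ⟨n + 1, by rw [Function.iterate_succ_apply', hn]⟩

theorem IsRooted.mem_periodicPts {g : V → V} {r : V} (h : IsRooted g r) :
    r ∈ Function.periodicPts g := by
  obtain ⟨n, hn⟩ := h (g r)
  exact ⟨n + 1, n.succ_pos, by
    rw [Function.IsPeriodicPt, Function.IsFixedPt, Function.iterate_succ_apply, hn]⟩

/-- A map rooted at `s` is also rooted at every vertex of its cycle, and exactly one of these, the
predecessor of `s` on the cycle, is mapped to `s`. This is the bijection that makes the measure on
rooted maps stationary when the root moves. -/
theorem IsRooted.existsUnique {g : V → V} {s : V} (h : IsRooted g s) :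
    ∃! u, g u = s ∧ IsRooted g u := by
  obtain ⟨n, hn⟩ := h (g s)
  have hgn : g (g^[n] s) = s := by
    rw [← Function.iterate_succ_apply' g, Function.iterate_succ_apply, hn]
  refine ⟨g^[n] s, ⟨hgn, fun v => ?_⟩, fun u ⟨hu, hu'⟩ => ?_⟩
  · obtain ⟨m, hm⟩ := h v
    exact ⟨n + m, by rw [Function.iterate_add_apply, hm]⟩
  · refine (Function.bijOn_periodicPts g).injOn hu'.mem_periodicPts ?_ (hu.trans hgn.symm)
    exact ((Function.bijOn_periodicPts g).mapsTo.iterate n) h.mem_periodicPts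

theorem IsRooted.of_agree {g g' : V → V} {u : V} (h : IsRooted g u)
    (hg : ∀ v, v ≠ u → g' v = g v) : IsRooted g' u := by
  intro v
  obtain ⟨n, hn⟩ := h v
  induction n generalizing v with
  | zero => exact ⟨0, hn⟩
  | succ n ih =>
    by_cases hv : v = u
    · exact ⟨0, hv⟩
    · obtain ⟨m, hm⟩ := ih (g v) hn
      exact ⟨m + 1, by rw [Function.iterate_succ_apply, hg v hv, hm]⟩

/-- Being rooted at `u` does not depend on the value at `u`. -/
theorem isRooted_congr {g g' : V → V} {u : V} (hg : ∀ v, v ≠ u → g' v = g v) :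
    IsRooted g' u ↔ IsRooted g u :=
  ⟨fun h => h.of_agree fun v hv => (hg v hv).symm, fun h => h.of_agree hg⟩

theorem isRooted_of_lt (d : V → ℕ) {g : V → V} {r : V} (h : ∀ v, v ≠ r → d (g v) < d v) :
    IsRooted g r := by
  intro v
  induction hd : d v using Nat.strong_induction_on generalizing v with
  | _ k ih =>
    by_cases hv : v = r
    · exact ⟨0, hv⟩
    · obtain ⟨n, hn⟩ := ih _ (hd ▸ h v hv) (g v) rfl
      exact ⟨n + 1, hn⟩

variable [Fintype V] [DecidableEq V]

/-- The weight of a map `g`: the probability of `g` when the values `g v` are independent with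
laws `K v`. -/
def weight (K : Matrix V V ℝ) (g : V → V) : ℝ := ∏ v, K v (g v)

omit [DecidableEq V] in
theorem weight_nonneg {K : Matrix V V ℝ} (hK : ∀ a b, 0 ≤ K a b) (g : V → V) :
    0 ≤ weight K g := Finset.prod_nonneg fun _ _ => hK _ _

theorem weight_update (K : Matrix V V ℝ) (g : V → V) (u x : V) :
    weight K (Function.update g u x) = K u x * ∏ v ∈ Finset.univ.erase u, K v (g v) := by
  rw [weight, ← Finset.mul_prod_erase _ _ (Finset.mem_univ u), Function.update_self]
  congr 1
  refine Finset.prod_congr rfl fun v hv => ?_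
  rw [Function.update_of_ne (Finset.ne_of_mem_erase hv)]

/-- Summing over all maps is summing over those with prescribed value at `u` and then over the
value at `u`. -/
theorem sum_eq_sum_update (u : V) (s : V) (F : (V → V) → ℝ) :
    ∑ g, F g = ∑ g, if g u = s then ∑ x, F (Function.update g u x) else 0 := by
  have key : ∀ x, ∑ g : V → V, (if g u = s then F (Function.update g u x) else 0) =
      ∑ g : V → V, if g u = x then F g else 0 := by
    intro x
    rw [← Finset.sum_filter, ← Finset.sum_filter]
    refine Finset.sum_bij' (fun g _ => Function.update g u x) (fun g _ => Function.update g u s)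
      ?_ ?_ ?_ ?_ ?_
    · simp
    · simp
    · intro g hg
      rw [Function.update_idem]
      simp only [Finset.mem_filter] at hg
      rw [← hg.2, Function.update_eq_self]
    · intro g hg
      rw [Function.update_idem]
      simp only [Finset.mem_filter] at hg
      rw [← hg.2, Function.update_eq_self]
    · simp
  calc ∑ g, F g = ∑ g, ∑ x, if g u = x then F g else 0 := by simp
    _ = ∑ x, ∑ g : V → V, if g u = s then F (Function.update g u x) else 0 := by
      rw [Finset.sum_comm]
      exact Finset.sum_congr rfl fun x _ => (key x).symm
    _ = _ := by
      rw [Finset.sum_comm]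
      refine Finset.sum_congr rfl fun g _ => ?_
      split_ifs <;> simp

/-- Resampling the value at `u`, which has law `K u` independently of the other values. -/
theorem sum_weight_mul_update {K : Matrix V V ℝ} (hK : ∀ a, ∑ b, K a b = 1) (u s : V)
    (f : (V → V) → ℝ) :
    K u s * ∑ g, weight K g * f (Function.update g u s) =
      ∑ g, if g u = s then weight K g * f g else 0 := by
  rw [sum_eq_sum_update u s, Finset.mul_sum]
  refine Finset.sum_congr rfl fun g _ => ?_
  split_ifs with h
  · have hg : Function.update g u s = g := by rw [← h, Function.update_eq_self]
    have hw := weight_update K g u s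
    rw [hg] at hw
    simp only [Function.update_idem, hg, weight_update]
    rw [← Finset.sum_mul, ← Finset.sum_mul, hK, hw]
    ring
  · simp

open scoped Classical in
/-- Moving the root from `u` to `s = g u`: averages over the maps rooted at `s` are obtained from
averages over the maps rooted at `u` by setting the value at `u` to `s`, with weight `K u s`. This
is the stationarity behind the Markov chain tree theorem. -/
theorem sum_rooted_eq {K : Matrix V V ℝ} (hK : ∀ a, ∑ b, K a b = 1) (s : V)
    (a : (V → V) → ℝ) :
    ∑ g, (if IsRooted g s then weight K g * a g else 0) =
      ∑ u, K u s * ∑ g, if IsRooted g u then weight K g * a (Function.update g u s) else 0 := by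
  have h1 : ∀ g : V → V, (if IsRooted g s then weight K g * a g else 0) =
      ∑ u, if g u = s then weight K g * (if IsRooted g u then a g else 0) else 0 := by
    intro g
    split_ifs with h
    · obtain ⟨u, ⟨hu, hu'⟩, huniq⟩ := h.existsUnique
      rw [Finset.sum_eq_single u]
      · simp [hu, hu']
      · intro b _ hb
        split_ifs with h1 h2
        · exact absurd (huniq b ⟨h1, h2⟩) hb
        · simp
        · rfl
      · simp
    · symm
      refine Finset.sum_eq_zero fun u _ => ?_
      split_ifs with h1 h2
      · exact absurd (h1 ▸ h2.apply) h
      · simp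
      · rfl
  simp_rw [h1]
  rw [Finset.sum_comm]
  refine Finset.sum_congr rfl fun u _ => ?_
  rw [← sum_weight_mul_update hK u s fun g => if IsRooted g u then a g else 0]
  congr 1
  refine Finset.sum_congr rfl fun g _ => ?_
  have : IsRooted (Function.update g u s) u ↔ IsRooted g u :=
    isRooted_congr fun v hv => Function.update_of_ne hv _ _
  simp only [this]
  split_ifs <;> simp

open scoped Classical in
/-- The total weight of the maps rooted at `r`. When the rows of `K` sum to one, this is the total
weight of the spanning trees rooted at `r`. -/
noncomputable def rootedWeight (K : Matrix V V ℝ) (r : V) : ℝ :=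
  ∑ g, if IsRooted g r then weight K g else 0

/-- The Markov chain tree theorem: the weights of the rooted trees form an invariant measure. -/
theorem vecMul_rootedWeight {K : Matrix V V ℝ} (hK : ∀ a, ∑ b, K a b = 1) (s : V) :
    ∑ u, rootedWeight K u * K u s = rootedWeight K s := by
  have := sum_rooted_eq hK s (fun _ => 1)
  simp only [mul_one] at this
  rw [rootedWeight, this]
  exact Finset.sum_congr rfl fun u _ => mul_comm _ _

open scoped Classical in
/-- Summing out the free value at the root leaves the weight of the tree. -/
theorem sum_rooted_agree {K : Matrix V V ℝ} (hK : ∀ a, ∑ b, K a b = 1) {p : V → V} {r : V}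
    (hp : IsRooted p r) :
    ∑ g, (if IsRooted g r then weight K g * (if ∀ v, v ≠ r → g v = p v then 1 else 0) else 0) =
      ∏ v ∈ Finset.univ.erase r, K v (p v) := by
  have h1 : ∀ g : V → V, (if IsRooted g r then
      weight K g * (if ∀ v, v ≠ r → g v = p v then (1 : ℝ) else 0) else 0) =
      if ∀ v, v ≠ r → g v = p v then weight K g else 0 := by
    intro g
    by_cases h : ∀ v, v ≠ r → g v = p v
    · rw [if_pos (hp.of_agree h), if_pos h, if_pos h, mul_one]
    · simp [h]
  simp_rw [h1]
  rw [sum_eq_sum_update r (p r), Finset.sum_eq_single p]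
  · rw [if_pos rfl]
    have : ∀ x, ∀ v, v ≠ r → Function.update p r x v = p v :=
      fun x v hv => Function.update_of_ne hv _ _
    rw [Finset.sum_congr rfl fun x _ => if_pos (this x)]
    simp_rw [weight_update]
    rw [← Finset.sum_mul, hK, one_mul]
  · intro g _ hg
    split_ifs with h
    · refine Finset.sum_eq_zero fun x _ => if_neg fun h2 => hg ?_
      funext v
      by_cases hv : v = r
      · rw [hv, h]
      · rw [← h2 v hv, Function.update_of_ne hv]
    · rfl
  · simp

/-! ### Invariant measures and the time reversal -/

omit [DecidableEq V] in
/-- A nonnegative invariant measure of an irreducible kernel that vanishes at one vertex vanishes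
at its neighbours, hence everywhere. -/
theorem eq_zero_of_invariant {E : Set (Sym2 V)} (hE : (SimpleGraph.fromEdgeSet E).Connected)
    {K : Matrix V V ℝ} (hK : ∀ a b, 0 ≤ K a b) (hpos : ∀ a b, s(a, b) ∈ E → 0 < K a b)
    {D : V → ℝ} (hD : ∀ v, 0 ≤ D v) (hinv : ∀ v, ∑ u, D u * K u v = D v)
    {v₀ : V} (h₀ : D v₀ = 0) (v : V) : D v = 0 := by
  obtain ⟨w⟩ := hE.preconnected v₀ v
  induction w with
  | nil => exact h₀
  | @cons a b c hab _ ih =>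
    refine ih ?_
    have h := hinv a
    rw [h₀, Finset.sum_eq_zero_iff_of_nonneg fun u _ => mul_nonneg (hD u) (hK u a)] at h
    have hE' : s(b, a) ∈ E := by
      rw [Sym2.eq_swap]; exact ((SimpleGraph.fromEdgeSet_adj _).1 hab).1
    exact (mul_eq_zero.1 (h b (Finset.mem_univ b))).resolve_right (hpos b a hE').ne'

omit [DecidableEq V] in
/-- Uniqueness of the invariant measure: `N - k ρ`, where `k` is the least ratio `N v / ρ v`, is
nonnegative, invariant and vanishes somewhere. -/
theorem eq_mul_of_invariant {E : Set (Sym2 V)} (hE : (SimpleGraph.fromEdgeSet E).Connected)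
    {K : Matrix V V ℝ} (hK : ∀ a b, 0 ≤ K a b) (hpos : ∀ a b, s(a, b) ∈ E → 0 < K a b)
    {ρ N : V → ℝ} (hρ : ∀ v, 0 < ρ v) (hρinv : ∀ v, ∑ u, ρ u * K u v = ρ v)
    (hρsum : ∑ v, ρ v = 1) (hN : ∀ v, ∑ u, N u * K u v = N v) (v : V) :
    N v = (∑ u, N u) * ρ v := by
  have := hE.nonempty
  obtain ⟨v₀, hv₀⟩ := Finite.exists_min fun v => N v / ρ v
  set k := N v₀ / ρ v₀
  have hzero : ∀ v, N v - k * ρ v = 0 := by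
    refine eq_zero_of_invariant hE hK hpos (v₀ := v₀) ?_ ?_ ?_
    · intro v
      have := (le_div_iff₀ (hρ v)).1 (hv₀ v)
      linarith
    · intro v
      simp_rw [sub_mul, mul_assoc]
      rw [Finset.sum_sub_distrib, ← Finset.mul_sum, hN, hρinv]
    · rw [div_mul_cancel₀ _ (hρ v₀).ne', sub_self]
  have hk : ∀ v, N v = k * ρ v := fun v => sub_eq_zero.1 (hzero v)
  have : ∑ u, N u = k := by
    rw [Finset.sum_congr rfl fun u _ => hk u, ← Finset.mul_sum, hρsum, mul_one]
  rw [this, hk]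

section kernel

variable {E : Set (Sym2 V)} {M : Matrix V V ℝ} {ρ : V → ℝ}

omit [DecidableEq V] in
theorem IsInvariantDistribution.sum_eq (hρ : IsInvariantDistribution M ρ) (v : V) :
    ∑ u, ρ u * M u v = ρ v := congrFun hρ.invariant v

theorem IsPositiveKernel.nonneg (hM : IsPositiveKernel E M) (a b : V) : 0 ≤ M a b :=
  hM.stochastic.1 a b

theorem IsPositiveKernel.sum_row (hM : IsPositiveKernel E M) (a : V) : ∑ b, M a b = 1 :=
  Matrix.sum_row_of_mem_rowStochastic hM.stochastic a

theorem invariant_pos (hE : (SimpleGraph.fromEdgeSet E).Connected)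
    (hM : IsPositiveKernel E M) (hρ : IsInvariantDistribution M ρ) (v : V) : 0 < ρ v := by
  refine (hρ.mem_stdSimplex.1 v).lt_of_ne fun h => ?_
  have h0 := eq_zero_of_invariant hE hM.nonneg (fun a b => (hM.pos_iff a b).2)
    hρ.mem_stdSimplex.1 hρ.sum_eq h.symm
  have := hρ.mem_stdSimplex.2
  simp [h0] at this

theorem reversal_nonneg (hE : (SimpleGraph.fromEdgeSet E).Connected)
    (hM : IsPositiveKernel E M) (hρ : IsInvariantDistribution M ρ) (a b : V) :
    0 ≤ reversal M ρ a b :=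
  div_nonneg (mul_nonneg (invariant_pos hE hM hρ b).le (hM.nonneg b a))
    (invariant_pos hE hM hρ a).le

theorem reversal_pos (hE : (SimpleGraph.fromEdgeSet E).Connected)
    (hM : IsPositiveKernel E M) (hρ : IsInvariantDistribution M ρ) (a b : V)
    (h : s(a, b) ∈ E) : 0 < reversal M ρ a b :=
  div_pos (mul_pos (invariant_pos hE hM hρ b) ((hM.pos_iff b a).2 (Sym2.eq_swap ▸ h)))
    (invariant_pos hE hM hρ a)

theorem sum_reversal (hE : (SimpleGraph.fromEdgeSet E).Connected)
    (hM : IsPositiveKernel E M) (hρ : IsInvariantDistribution M ρ) (a : V) :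
    ∑ b, reversal M ρ a b = 1 := by
  simp only [reversal, Matrix.of_apply]
  rw [← Finset.sum_div, hρ.sum_eq, div_self (invariant_pos hE hM hρ a).ne']

theorem invariant_reversal (hE : (SimpleGraph.fromEdgeSet E).Connected)
    (hM : IsPositiveKernel E M) (hρ : IsInvariantDistribution M ρ) (v : V) :
    ∑ u, ρ u * reversal M ρ u v = ρ v := by
  have : ∀ u, ρ u * reversal M ρ u v = ρ v * M v u := fun u => by
    simp only [reversal, Matrix.of_apply]
    rw [mul_div_cancel₀ _ (invariant_pos hE hM hρ u).ne']
  rw [Finset.sum_congr rfl fun u _ => this u, ← Finset.mul_sum, hM.sum_row, mul_one]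

theorem exists_isRooted_weight_pos (hE : (SimpleGraph.fromEdgeSet E).Connected)
    {K : Matrix V V ℝ} (hsum : ∀ a, ∑ b, K a b = 1)
    (hpos : ∀ a b, s(a, b) ∈ E → 0 < K a b) (r : V) :
    ∃ g, IsRooted g r ∧ 0 < weight K g := by
  have hex : ∀ v, ∃ u, 0 < K v u ∧ (v ≠ r → (SimpleGraph.fromEdgeSet E).dist u r <
      (SimpleGraph.fromEdgeSet E).dist v r) := by
    intro v
    by_cases hv : v = r
    · obtain ⟨u, -, hu⟩ := Finset.exists_lt_of_sum_lt
        (s := Finset.univ) (f := fun _ => (0 : ℝ)) (g := fun u => K v u) (by simp [hsum])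
      exact ⟨u, hu, fun h => absurd hv h⟩
    · obtain ⟨w, hw⟩ := (hE.preconnected v r).exists_walk_length_eq_dist
      cases w with
      | nil => exact absurd rfl hv
      | @cons _ u _ h w =>
        refine ⟨u, hpos _ _ ((SimpleGraph.fromEdgeSet_adj _).1 h).1, fun _ => ?_⟩
        rw [← hw, SimpleGraph.Walk.length_cons]
        exact Nat.lt_succ_of_le (SimpleGraph.dist_le w)
  choose g hg hd using hex
  exact ⟨g, isRooted_of_lt (fun v => (SimpleGraph.fromEdgeSet E).dist v r) hd,
    Finset.prod_pos fun v _ => hg v⟩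

theorem sum_rootedWeight_pos (hE : (SimpleGraph.fromEdgeSet E).Connected)
    {K : Matrix V V ℝ} (hK : ∀ a b, 0 ≤ K a b) (hsum : ∀ a, ∑ b, K a b = 1)
    (hpos : ∀ a b, s(a, b) ∈ E → 0 < K a b) : 0 < ∑ r, rootedWeight K r := by
  classical
  obtain ⟨r⟩ := hE.nonempty
  have hnn : ∀ r g, 0 ≤ if IsRooted g r then weight K g else 0 := fun r g => by
    split_ifs
    exacts [weight_nonneg hK g, le_rfl]
  obtain ⟨g, hg, hw⟩ := exists_isRooted_weight_pos hE hsum hpos r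
  refine Finset.sum_pos' (fun r _ => Finset.sum_nonneg fun g _ => hnn r g)
    ⟨r, Finset.mem_univ r, Finset.sum_pos' (fun g _ => hnn r g) ⟨g, Finset.mem_univ g, ?_⟩⟩
  rwa [if_pos hg]

end kernel

end map

/-! ### Parent maps of rooted spanning trees -/

section tree

variable {V : Type*} {E : Set (Sym2 V)}

theorem RootedSpanningTree.existsUnique_parent (t : RootedSpanningTree E) {v : V}
    (hv : v ≠ t.root) :
    ∃! u, t.tree.Adj v u ∧ t.tree.dist v t.root = t.tree.dist u t.root + 1 := by
  obtain ⟨w, hw, hw'⟩ := (t.isTree.connected.preconnected v t.root).exists_path_of_dist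
  cases w with
  | nil => exact absurd rfl hv
  | @cons _ u _ h w =>
    have hd : t.tree.dist v t.root = t.tree.dist u t.root + 1 := by
      rcases t.isTree.dist_eq_dist_add_one_of_adj t.root h with h' | h' <;>
        rw [t.tree.dist_comm (u := t.root), t.tree.dist_comm (u := t.root)] at h'
      · exact h'
      · have := SimpleGraph.dist_le w
        rw [SimpleGraph.Walk.length_cons] at hw'
        omega
    refine ⟨u, ⟨h, hd⟩, fun u' ⟨h', hd'⟩ => ?_⟩
    obtain ⟨q, hq⟩ :=
      (t.isTree.connected.preconnected u' t.root).exists_walk_length_eq_dist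
    have hpath : (SimpleGraph.Walk.cons h' q).IsPath := by
      refine SimpleGraph.Walk.isPath_of_length_eq_dist _ ?_
      rw [SimpleGraph.Walk.length_cons, hq, hd']
    have heq := (t.isTree.existsUnique_path v t.root).unique hpath hw
    have := congrArg SimpleGraph.Walk.snd heq
    simpa using this

variable [Fintype V] [DecidableEq V]

/-- The value of the parent map at the root plays no role. -/
theorem RootedSpanningTree.exists_parentMap (t : RootedSpanningTree E) :
    ∃ p : V → V, IsRooted p t.root ∧
      t.edges = (Finset.univ.erase t.root).image fun v => (v, p v) := by
  have hex : ∀ v, ∃ u, v ≠ t.root →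
      t.tree.Adj v u ∧ t.tree.dist v t.root = t.tree.dist u t.root + 1 := fun v => by
    by_cases hv : v = t.root
    · exact ⟨v, fun h => absurd hv h⟩
    · exact (t.existsUnique_parent hv).exists.imp fun u hu _ => hu
  choose p hp using hex
  refine ⟨p, isRooted_of_lt (fun v => t.tree.dist v t.root) fun v hv => ?_, ?_⟩
  · have := (hp v hv).2
    omega
  · ext ⟨a, b⟩
    simp only [RootedSpanningTree.edges, Finset.mem_filter, Finset.mem_univ, true_and,
      Finset.mem_image, Finset.mem_erase, and_true, Prod.mk.injEq]
    constructor
    · rintro ⟨h, hd⟩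
      have ha : a ≠ t.root := by
        rintro rfl
        simp at hd
      exact ⟨a, ha, rfl, (t.existsUnique_parent ha).unique (hp a ha) ⟨h, hd⟩⟩
    · rintro ⟨v, hv, rfl, rfl⟩
      exact hp v hv

end tree

/-! ### First-entrance trees of trajectories -/

section trajectory

variable {V : Type*} [DecidableEq V]

/-- The vertex occupied just before the first visit to `v`. By truncated subtraction it is `w 0` if
`v = w 0`; if `v` is never visited, the value has no meaning. -/
noncomputable def firstPred (w : ℕ → V) (v : V) : V := w (sInf {j | w j = v} - 1)

theorem mem_visited {w : ℕ → V} {j : ℕ} {v : V} : v ∈ visited w j ↔ ∃ i ≤ j, w i = v := by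
  simp [visited]

theorem visited_zero (w : ℕ → V) : visited w 0 = {w 0} := by simp [visited]

theorem visited_succ (w : ℕ → V) (j : ℕ) :
    visited w (j + 1) = insert (w (j + 1)) (visited w j) := by
  rw [visited, Finset.range_add_one, Finset.image_insert, visited]

theorem visited_mono (w : ℕ → V) : Monotone (visited w) := fun _ _ h _ hv => by
  obtain ⟨k, hk, rfl⟩ := mem_visited.1 hv
  exact mem_visited.2 ⟨k, hk.trans h, rfl⟩

theorem visited_congr {w w' : ℕ → V} {n : ℕ} (h : ∀ i ≤ n, w i = w' i) :
    visited w n = visited w' n := by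
  ext v
  simp only [mem_visited]
  exact exists_congr fun i => and_congr_right fun hi => by rw [h i hi]

theorem sInf_eq_of_notMem_visited {w : ℕ → V} {m : ℕ} (h : w (m + 1) ∉ visited w m) :
    sInf {j | w j = w (m + 1)} = m + 1 := by
  refine le_antisymm (Nat.sInf_le rfl) ?_
  by_contra! hlt
  have hmem : w (sInf {j | w j = w (m + 1)}) = w (m + 1) :=
    Nat.sInf_mem (s := {j | w j = w (m + 1)}) ⟨m + 1, rfl⟩
  exact h (mem_visited.2 ⟨_, Nat.le_of_lt_succ hlt, hmem⟩)

theorem firstPred_of_notMem_visited {w : ℕ → V} {m : ℕ} (h : w (m + 1) ∉ visited w m) :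
    firstPred w (w (m + 1)) = w m := by
  rw [firstPred, sInf_eq_of_notMem_visited h, Nat.add_sub_cancel]

theorem visitTime_card_visited {w : ℕ → V} {m : ℕ} (h : w (m + 1) ∉ visited w m) :
    visitTime w (visited w (m + 1)).card = m + 1 := by
  refine le_antisymm (Nat.sInf_le rfl) (le_csInf ⟨m + 1, rfl⟩ fun j hj => ?_)
  by_contra! hlt
  have h1 := Finset.card_le_card (visited_mono w (Nat.le_of_lt_succ hlt))
  rw [Set.mem_ofPred_eq, visited_succ, Finset.card_insert_of_notMem h] at hj
  omega

theorem exists_card_visited_eq (w : ℕ → V) {k : ℕ} (hk : 1 ≤ k) (n : ℕ)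
    (hn : k ≤ (visited w n).card) : ∃ j, (visited w j).card = k := by
  induction n with
  | zero =>
    rw [visited_zero, Finset.card_singleton] at hn
    exact ⟨0, by rw [visited_zero, Finset.card_singleton]; omega⟩
  | succ n ih =>
    by_cases h : k ≤ (visited w n).card
    · exact ih h
    · have := Finset.card_insert_le (w (n + 1)) (visited w n)
      rw [← visited_succ] at this
      exact ⟨n + 1, by omega⟩

/-- The first-entrance tree of `w 0, …, w n`, completed by `g` at the vertices not yet visited. -/
noncomputable def entranceMap (w : ℕ → V) (n : ℕ) (g : V → V) (v : V) : V :=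
  if v ∈ visited w n then firstPred w v else g v

theorem entranceMap_zero (w : ℕ → V) (g : V → V) {v : V} (hv : v ≠ w 0) :
    entranceMap w 0 g v = g v := by
  rw [entranceMap, if_neg]
  rwa [visited_zero, Finset.mem_singleton]

/-- A further step can be absorbed into the completing map: if `w (n + 1)` is new, it is first
entered from `w n`; otherwise the completing map is not used there. -/
theorem entranceMap_succ (w : ℕ → V) (n : ℕ) (g : V → V) :
    entranceMap w (n + 1) g = entranceMap w n (Function.update g (w (n + 1)) (w n)) := by
  funext v
  by_cases hv : v ∈ visited w n
  · rw [entranceMap, entranceMap, if_pos hv, if_pos (visited_mono w n.le_succ hv)]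
  · rw [entranceMap, entranceMap, if_neg hv, visited_succ]
    by_cases hu : v = w (n + 1)
    · subst hu
      rw [if_pos (Finset.mem_insert_self _ _), Function.update_self,
        firstPred_of_notMem_visited hv]
    · rw [if_neg (by simp [hu, hv]), Function.update_of_ne hu]

theorem entranceMap_congr {w w' : ℕ → V} {n : ℕ} (h : ∀ i ≤ n, w i = w' i) (g : V → V) :
    entranceMap w n g = entranceMap w' n g := by
  funext v
  rw [entranceMap, entranceMap, visited_congr h]
  by_cases hv : v ∈ visited w' n
  · rw [if_pos hv, if_pos hv]
    obtain ⟨i, hi, rfl⟩ := mem_visited.1 hv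
    have key : ∀ {a b : ℕ → V}, (∀ i ≤ n, a i = b i) → b i = w' i →
        sInf {j | b j = w' i} ≤ n ∧ sInf {j | a j = w' i} ≤ sInf {j | b j = w' i} := by
      intro a b hab hb
      have hle : sInf {j | b j = w' i} ≤ n := (Nat.sInf_le hb).trans hi
      have hmem : b (sInf {j | b j = w' i}) = w' i := Nat.sInf_mem (s := {j | b j = w' i}) ⟨i, hb⟩
      exact ⟨hle, Nat.sInf_le (by rw [Set.mem_ofPred_eq, hab _ hle, hmem])⟩
    have h1 := key h rfl
    have h2 := key (fun j hj => (h j hj).symm) (h i hi)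
    rw [firstPred, firstPred, le_antisymm h1.2 h2.2]
    exact h _ ((Nat.sub_le _ _).trans h1.1)
  · rw [if_neg hv, if_neg hv]

variable [Fintype V]

theorem entranceMap_of_card {w : ℕ → V} {n : ℕ} (h : (visited w n).card = Fintype.card V)
    (g : V → V) : entranceMap w n g = firstPred w := by
  funext v
  rw [entranceMap, if_pos]
  rw [(Finset.card_eq_iff_eq_univ _).1 h]
  exact Finset.mem_univ v

theorem firstEntranceTree_eq {w : ℕ → V} (hw : Covers w) :
    firstEntranceTree w =
      ((Finset.univ.erase (w 0)).image fun v => (v, firstPred w v), w 0) := by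
  obtain ⟨N, hN⟩ := hw
  rw [firstEntranceTree]
  refine Prod.ext ?_ rfl
  ext e
  simp only [Finset.mem_image, Finset.mem_Icc, Finset.mem_erase, Finset.mem_univ, and_true]
  constructor
  · rintro ⟨k, ⟨hk2, hkV⟩, rfl⟩
    have hne : {j | (visited w j).card = k}.Nonempty :=
      exists_card_visited_eq w (by omega) N (hN ▸ hkV)
    have hτ : (visited w (visitTime w k)).card = k := Nat.sInf_mem hne
    have hlt : ∀ j, j < visitTime w k → (visited w j).card ≠ k :=
      fun j hj => Nat.notMem_of_lt_sInf (s := {j | (visited w j).card = k}) hj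
    cases hm : visitTime w k with
    | zero =>
      rw [hm, visited_zero, Finset.card_singleton] at hτ
      omega
    | succ m =>
      rw [hm] at hτ
      have hnew : w (m + 1) ∉ visited w m := fun h => by
        rw [visited_succ, Finset.insert_eq_of_mem h] at hτ
        exact hlt m (by omega) hτ
      refine ⟨w (m + 1), fun h => hnew (mem_visited.2 ⟨0, m.zero_le, h.symm⟩), ?_⟩
      rw [firstPred_of_notMem_visited hnew, Nat.add_sub_cancel]
  · rintro ⟨v, hv, rfl⟩
    have hvis : v ∈ visited w N := by
      rw [(Finset.card_eq_iff_eq_univ _).1 hN]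
      exact Finset.mem_univ v
    obtain ⟨j, -, hj⟩ := mem_visited.1 hvis
    have hτ : w (sInf {j | w j = v}) = v := Nat.sInf_mem (s := {j | w j = v}) ⟨j, hj⟩
    have hlt : ∀ i, i < sInf {j | w j = v} → w i ≠ v := fun i hi =>
      Nat.notMem_of_lt_sInf (s := {j | w j = v}) hi
    cases hm : sInf {j | w j = v} with
    | zero =>
      rw [hm] at hτ
      exact absurd hτ.symm hv
    | succ m =>
      rw [hm] at hτ
      have hnew : w (m + 1) ∉ visited w m := fun h => by
        obtain ⟨i, hi, hi'⟩ := mem_visited.1 h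
        exact hlt i (by omega) (hi'.trans hτ)
      refine ⟨(visited w (m + 1)).card, ⟨?_, Finset.card_le_univ _⟩, ?_⟩
      · rw [visited_succ, Finset.card_insert_of_notMem hnew]
        have : 0 < (visited w m).card :=
          Finset.card_pos.2 ⟨w 0, mem_visited.2 ⟨0, m.zero_le, rfl⟩⟩
        omega
      · rw [visitTime_card_visited hnew, Nat.add_sub_cancel, ← hτ,
          firstPred_of_notMem_visited hnew]

theorem firstEntranceTree_eq_iff {E : Set (Sym2 V)} {t : RootedSpanningTree E} {p : V → V}
    (hp : t.edges = (Finset.univ.erase t.root).image fun v => (v, p v)) {w : ℕ → V}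
    (hw : Covers w) :
    firstEntranceTree w = (t.edges, t.root) ↔
      w 0 = t.root ∧ ∀ v, v ≠ t.root → firstPred w v = p v := by
  rw [firstEntranceTree_eq hw, hp, Prod.mk.injEq, and_comm]
  refine and_congr_right fun h0 => ?_
  rw [h0]
  constructor
  · intro h v hv
    have : (v, firstPred w v) ∈ (Finset.univ.erase t.root).image fun v => (v, p v) :=
      h ▸ Finset.mem_image.2 ⟨v, by simp [hv], rfl⟩
    simp only [Finset.mem_image, Prod.mk.injEq] at this
    obtain ⟨a, -, rfl, ha⟩ := this
    exact ha.symm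
  · intro h
    refine Finset.image_congr fun v hv => ?_
    rw [h v (by simpa using hv)]

end trajectory

/-! ### Finiteness of the cover time -/

section killed

variable {V : Type*} [Fintype V] [DecidableEq V]

/-- The mass at `x` at time `n` of the chain started from `ρ` and killed when it visits `v`. -/
noncomputable def killed (M : Matrix V V ℝ) (ρ : V → ℝ) (v : V) : ℕ → V → ℝ
  | 0, x => if x = v then 0 else ρ x
  | n + 1, x => if x = v then 0 else ∑ s, killed M ρ v n s * M s x

variable {E : Set (Sym2 V)} {M : Matrix V V ℝ} {ρ : V → ℝ}

theorem killed_self (v : V) (n : ℕ) : killed M ρ v n v = 0 := by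
  cases n <;> simp [killed]

theorem killed_nonneg (hM : IsPositiveKernel E M) (hρ : IsInvariantDistribution M ρ) (v : V)
    (n : ℕ) (x : V) : 0 ≤ killed M ρ v n x := by
  induction n generalizing x with
  | zero =>
    rw [killed]
    split_ifs
    exacts [le_rfl, hρ.mem_stdSimplex.1 x]
  | succ n ih =>
    rw [killed]
    split_ifs
    exacts [le_rfl, Finset.sum_nonneg fun s _ => mul_nonneg (ih s) (hM.nonneg s x)]

theorem killed_antitone (hM : IsPositiveKernel E M) (hρ : IsInvariantDistribution M ρ) (v : V)
    (x : V) : Antitone fun n => killed M ρ v n x := by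
  refine antitone_nat_of_succ_le fun n => ?_
  induction n generalizing x with
  | zero =>
    rw [killed, killed]
    split_ifs
    · exact le_rfl
    · rw [← hρ.sum_eq x]
      refine Finset.sum_le_sum fun s _ => mul_le_mul_of_nonneg_right ?_ (hM.nonneg s x)
      rw [killed]
      split_ifs
      exacts [hρ.mem_stdSimplex.1 s, le_rfl]
  | succ n ih =>
    rw [killed]
    conv_rhs => rw [killed]
    split_ifs
    · exact le_rfl
    · exact Finset.sum_le_sum fun s _ => mul_le_mul_of_nonneg_right (ih s) (hM.nonneg s x)

/-- The killed masses decrease to a limit which, by conservation of mass, is an invariant measure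
vanishing at `v`, hence zero. -/
theorem tendsto_killed (hE : (SimpleGraph.fromEdgeSet E).Connected)
    (hM : IsPositiveKernel E M) (hρ : IsInvariantDistribution M ρ) (v x : V) :
    Tendsto (fun n => killed M ρ v n x) atTop (𝓝 0) := by
  have hlim : ∀ x, Tendsto (fun n => killed M ρ v n x) atTop (𝓝 (⨅ n, killed M ρ v n x)) :=
    fun x => tendsto_atTop_ciInf (killed_antitone hM hρ v x)
      ⟨0, by rintro _ ⟨n, rfl⟩; exact killed_nonneg hM hρ v n x⟩
  set D : V → ℝ := fun x => ⨅ n, killed M ρ v n x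
  have hDv : D v = 0 := by simp [D, killed_self]
  have hDnn : ∀ x, 0 ≤ D x := fun x => le_ciInf fun n => killed_nonneg hM hρ v n x
  have hstep : ∀ x, D x = if x = v then 0 else ∑ s, D s * M s x := by
    intro x
    refine tendsto_nhds_unique ((tendsto_add_atTop_iff_nat 1).2 (hlim x)) ?_
    simp only [killed]
    split_ifs
    · exact tendsto_const_nhds
    · exact tendsto_finsetSum _ fun s _ => (hlim s).mul_const _
  -- The total mass of `D` is unchanged by `M` and by the killing, so no mass is killed at `v`.
  have hin : ∑ s, D s * M s v = 0 := by
    have h1 : ∑ x, ∑ s, D s * M s x = ∑ x, D x := by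
      rw [Finset.sum_comm]
      refine Finset.sum_congr rfl fun s _ => ?_
      rw [← Finset.mul_sum, hM.sum_row, mul_one]
    have h2 : ∑ x ∈ Finset.univ.erase v, ∑ s, D s * M s x = ∑ x ∈ Finset.univ.erase v, D x :=
      Finset.sum_congr rfl fun x hx => by rw [hstep x, if_neg (Finset.ne_of_mem_erase hx)]
    rw [← Finset.add_sum_erase Finset.univ (fun x => ∑ s, D s * M s x) (Finset.mem_univ v),
      ← Finset.add_sum_erase Finset.univ D (Finset.mem_univ v), hDv, h2] at h1
    linarith
  have hzero := eq_zero_of_invariant hE hM.nonneg (fun a b => (hM.pos_iff a b).2) hDnn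
    (fun x => by
      by_cases hx : x = v
      · rw [hx, hin, hDv]
      · rw [hstep x, if_neg hx]) hDv x
  rw [← hzero]
  exact hlim x

end killed

section chain

variable {V Ω : Type*} [Fintype V] [MeasurableSpace Ω] {P : Measure Ω} [IsProbabilityMeasure P]

theorem sum_measureReal_inter_eq {X : Ω → V} (hX : ∀ v, MeasurableSet {ω | X ω = v})
    (A : Set Ω) : ∑ v, P.real {ω | ω ∈ A ∧ X ω = v} = P.real A := by
  have h := sum_measureReal_preimage_singleton (μ := P.restrict A) (f := X) Finset.univ
    fun v _ => hX v
  rw [Finset.coe_univ, Set.preimage_univ, measureReal_restrict_apply_univ] at h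
  rw [← h]
  refine Finset.sum_congr rfl fun v _ => ?_
  rw [measureReal_restrict_apply (show MeasurableSet (X ⁻¹' {v}) from hX v)]
  congr 1
  ext ω
  exact and_comm

variable {M : Matrix V V ℝ} {W : ℕ → Ω → V}

/-- The Markov property for an event `Φ` that depends on the trajectory up to time `n`. -/
theorem IsMarkovChain.measureReal_step (hW : IsMarkovChain M P W) (n : ℕ)
    {Φ : (ℕ → V) → Prop} (hΦ : ∀ w w', (∀ i ≤ n, w i = w' i) → (Φ w ↔ Φ w')) (s u : V) :
    P.real {ω | (Φ (fun i => W i ω) ∧ W n ω = s) ∧ W (n + 1) ω = u} =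
      P.real {ω | Φ (fun i => W i ω) ∧ W n ω = s} * M s u := by
  classical
  let X : Ω → (Fin (n + 1) → V) := fun ω i => W i ω
  let x : (Fin (n + 1) → V) → ℕ → V := fun y i => if h : i < n + 1 then y ⟨i, h⟩ else u
  have hx : ∀ ω, ∀ i ≤ n, W i ω = x (X ω) i := fun ω i hi => by
    simp only [x, X]
    rw [dif_pos (Nat.lt_succ_of_le hi)]
  have hpre : ∀ y, X ⁻¹' {y} = {ω | ∀ i ≤ n, W i ω = x y i} := by
    intro y
    ext ω
    simp only [Set.mem_preimage, Set.mem_singleton_iff, Set.mem_ofPred_eq]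
    constructor
    · rintro rfl
      exact hx ω
    · intro h
      funext i
      have := h i (Nat.le_of_lt_succ i.2)
      simp only [x] at this
      rwa [dif_pos i.2] at this
  have hxu : ∀ y, x y (n + 1) = u := fun y => dif_neg (lt_irrefl _)
  have hmeas : ∀ y, MeasurableSet (X ⁻¹' {y}) := by
    intro y
    rw [hpre]
    have : {ω | ∀ i ≤ n, W i ω = x y i} = ⋂ i, ⋂ (_ : i ≤ n), {ω | W i ω = x y i} := by
      ext; simp
    rw [this]
    exact MeasurableSet.iInter fun i => MeasurableSet.iInter fun _ => hW.measurableSet_eq _ _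
  let S : Finset (Fin (n + 1) → V) := Finset.univ.filter fun y => Φ (x y) ∧ x y n = s
  have hS : {ω | Φ (fun i => W i ω) ∧ W n ω = s} = X ⁻¹' (S : Set (Fin (n + 1) → V)) := by
    ext ω
    simp only [S, Set.mem_ofPred_eq, Set.mem_preimage, Finset.coe_filter, Finset.mem_univ,
      true_and]
    rw [hΦ _ _ (hx ω), hx ω n le_rfl]
  have h1 := sum_measureReal_preimage_singleton (μ := P) (f := X) S fun y _ => hmeas y
  have h2 := sum_measureReal_preimage_singleton (μ := P.restrict {ω | W (n + 1) ω = u})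
    (f := X) S fun y _ => hmeas y
  rw [← hS] at h1 h2
  rw [measureReal_restrict_apply' (hW.measurableSet_eq _ _)] at h2
  rw [← h1, Finset.sum_mul]
  refine Eq.trans (Eq.symm h2) (Finset.sum_congr rfl fun y hy => ?_)
  have hys : x y n = s := (Finset.mem_filter.1 hy).2.2
  have hstep := hW.step n (x y)
  rw [hys, hxu] at hstep
  rw [measureReal_restrict_apply (hmeas y), hpre, ← hstep]
  congr 1
  ext ω
  simp only [Set.mem_inter_iff, Set.mem_ofPred_eq, Nat.le_succ_iff]
  constructor
  · rintro ⟨h, h'⟩ i (hi | rfl)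
    exacts [h i hi, h'.trans (hxu y).symm]
  · exact fun h => ⟨fun i hi => h i (Or.inl hi), (h _ (Or.inr rfl)).trans (hxu y)⟩

variable [DecidableEq V] {E : Set (Sym2 V)} {ρ : V → ℝ}

/-- Any initial law is at most `(∑ u, (ρ u)⁻¹) • ρ`, so the chain avoiding `v` is dominated by the
killed chain started from `ρ`. -/
theorem IsMarkovChain.measureReal_notMem_visited_le (hW : IsMarkovChain M P W)
    (hE : (SimpleGraph.fromEdgeSet E).Connected)
    (hM : IsPositiveKernel E M) (hρ : IsInvariantDistribution M ρ) (v : V) (n : ℕ) (x : V) :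
    P.real {ω | v ∉ visited (fun i => W i ω) n ∧ W n ω = x} ≤
      (∑ u, (ρ u)⁻¹) * killed M ρ v n x := by
  have hρpos := invariant_pos hE hM hρ
  by_cases hxv : x = v
  · subst hxv
    have : {ω | x ∉ visited (fun i => W i ω) n ∧ W n ω = x} = ∅ := by
      ext ω
      simp only [Set.mem_ofPred_eq, Set.mem_empty_iff_false, iff_false, not_and]
      exact fun h h' => h (mem_visited.2 ⟨n, le_rfl, h'⟩)
    rw [this, killed_self]
    simp
  induction n generalizing x with
  | zero =>
    rw [killed, if_neg hxv]
    refine measureReal_le_one.trans ?_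
    rw [← inv_mul_cancel₀ (hρpos x).ne']
    exact mul_le_mul_of_nonneg_right (Finset.single_le_sum
      (f := fun u => (ρ u)⁻¹) (fun u _ => (inv_pos.2 (hρpos u)).le) (Finset.mem_univ x))
      (hρpos x).le
  | succ n ih =>
    rw [killed, if_neg hxv, Finset.mul_sum]
    have hsub : {ω | v ∉ visited (fun i => W i ω) (n + 1) ∧ W (n + 1) ω = x} ⊆
        {ω | v ∉ visited (fun i => W i ω) n ∧ W (n + 1) ω = x} := fun ω h =>
      ⟨fun h' => h.1 (visited_mono _ n.le_succ h'), h.2⟩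
    refine (measureReal_mono hsub).trans ?_
    rw [← sum_measureReal_inter_eq (hW.measurableSet_eq n)]
    refine Finset.sum_le_sum fun s _ => ?_
    have hset : {ω | ω ∈ {ω | v ∉ visited (fun i => W i ω) n ∧ W (n + 1) ω = x} ∧ W n ω = s} =
        {ω | (v ∉ visited (fun i => W i ω) n ∧ W n ω = s) ∧ W (n + 1) ω = x} := by
      ext ω
      exact and_right_comm
    rw [hset, hW.measureReal_step n (Φ := fun w => v ∉ visited w n)
      (fun w w' h => by rw [visited_congr h]), ← mul_assoc]
    refine mul_le_mul_of_nonneg_right ?_ (hM.nonneg s x)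
    by_cases hs : s = v
    · subst hs
      have : {ω | s ∉ visited (fun i => W i ω) n ∧ W n ω = s} = ∅ := by
        ext ω
        simp only [Set.mem_ofPred_eq, Set.mem_empty_iff_false, iff_false, not_and]
        exact fun h h' => h (mem_visited.2 ⟨n, le_rfl, h'⟩)
      rw [this, killed_self]
      simp
    · exact ih s hs

theorem IsMarkovChain.tendsto_notCovered (hW : IsMarkovChain M P W)
    (hE : (SimpleGraph.fromEdgeSet E).Connected)
    (hM : IsPositiveKernel E M) (hρ : IsInvariantDistribution M ρ) :
    Tendsto (fun n => P.real {ω | (visited (fun i => W i ω) n).card ≠ Fintype.card V}) atTop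
      (𝓝 0) := by
  have hlim : Tendsto (fun n => ∑ v, ∑ x, (∑ u, (ρ u)⁻¹) * killed M ρ v n x) atTop (𝓝 0) := by
    have : (0 : ℝ) = ∑ v : V, ∑ x : V, (∑ u, (ρ u)⁻¹) * 0 := by simp
    rw [this]
    exact tendsto_finsetSum _ fun v _ => tendsto_finsetSum _ fun x _ =>
      (tendsto_killed hE hM hρ v x).const_mul _
  refine squeeze_zero (fun n => measureReal_nonneg) (fun n => ?_) hlim
  have hsub : {ω | (visited (fun i => W i ω) n).card ≠ Fintype.card V} ⊆
      ⋃ v, {ω | v ∉ visited (fun i => W i ω) n} := by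
    intro ω h
    by_contra hcon
    simp only [Set.mem_iUnion, Set.mem_ofPred_eq, not_exists, not_not] at hcon
    exact h ((Finset.card_eq_iff_eq_univ _).2 (Finset.eq_univ_of_forall hcon))
  refine (measureReal_mono hsub).trans ((measureReal_iUnion_fintype_le _).trans ?_)
  refine Finset.sum_le_sum fun v _ => ?_
  rw [← sum_measureReal_inter_eq (hW.measurableSet_eq n)]
  exact Finset.sum_le_sum fun x _ => hW.measureReal_notMem_visited_le hE hM hρ v n x

theorem IsMarkovChain.ae_covers (hW : IsMarkovChain M P W)
    (hE : (SimpleGraph.fromEdgeSet E).Connected)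
    (hM : IsPositiveKernel E M) (hρ : IsInvariantDistribution M ρ) :
    ∀ᵐ ω ∂P, Covers fun n => W n ω := by
  rw [ae_iff, ← measureReal_eq_zero_iff]
  refine le_antisymm (ge_of_tendsto' (hW.tendsto_notCovered hE hM hρ) fun n => ?_)
    measureReal_nonneg
  exact measureReal_mono fun ω h h' => h ⟨n, h'⟩

/-! ### The first-entrance tree of the chain -/

open scoped Classical in
/-- The sum of `a` over the roots `s` and the maps rooted at `s`, with weight `weight K g / ρ s`. -/
noncomputable def rootedAverage (K : Matrix V V ℝ) (ρ : V → ℝ) (a : V → (V → V) → ℝ) : ℝ :=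
  ∑ s, (ρ s)⁻¹ * ∑ g, if IsRooted g s then weight K g * a s g else 0

theorem rootedAverage_mono {K : Matrix V V ℝ} (hK : ∀ a b, 0 ≤ K a b) (hρ : ∀ v, 0 < ρ v)
    {a b : V → (V → V) → ℝ} (hab : ∀ s g, a s g ≤ b s g) :
    rootedAverage K ρ a ≤ rootedAverage K ρ b := by
  refine Finset.sum_le_sum fun s _ => mul_le_mul_of_nonneg_left ?_ (inv_pos.2 (hρ s)).le
  refine Finset.sum_le_sum fun g _ => ?_
  split_ifs
  exacts [mul_le_mul_of_nonneg_left (hab s g) (weight_nonneg hK g), le_rfl]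

/-- The total weight of the maps rooted at `s` is proportional to `ρ s`, so the factor `1 / ρ s`
turns the average of a function of the root into a plain sum. -/
theorem rootedAverage_const (hE : (SimpleGraph.fromEdgeSet E).Connected)
    (hM : IsPositiveKernel E M) (hρ : IsInvariantDistribution M ρ) (a : V → ℝ) :
    rootedAverage (reversal M ρ) ρ (fun s _ => a s) =
      (∑ r, rootedWeight (reversal M ρ) r) * ∑ s, a s := by
  classical
  rw [rootedAverage, Finset.mul_sum]
  refine Finset.sum_congr rfl fun s _ => ?_
  have h1 := eq_mul_of_invariant hE (reversal_nonneg hE hM hρ) (reversal_pos hE hM hρ)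
    (invariant_pos hE hM hρ) (invariant_reversal hE hM hρ) hρ.mem_stdSimplex.2
    (vecMul_rootedWeight (sum_reversal hE hM hρ)) s
  have h2 : ∀ g : V → V, (if IsRooted g s then weight (reversal M ρ) g * a s else 0) =
      (if IsRooted g s then weight (reversal M ρ) g else 0) * a s := fun g => by
    split_ifs <;> simp
  simp_rw [h2]
  rw [← Finset.sum_mul, ← rootedWeight, h1]
  field_simp [(invariant_pos hE hM hρ s).ne']

/-- The probability that the chain starts at `r`, is at `s` at time `n`, and that its first-entrance
tree up to time `n`, completed by `g`, has the parent map `p` off `r`. -/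
noncomputable def entranceMass (P : Measure Ω) (W : ℕ → Ω → V) (r : V) (p : V → V) (n : ℕ)
    (s : V) (g : V → V) : ℝ :=
  P.real {ω | (W 0 ω = r ∧ ∀ v, v ≠ r → entranceMap (fun i => W i ω) n g v = p v) ∧ W n ω = s}

theorem IsMarkovChain.entranceMass_succ (hW : IsMarkovChain M P W) (r : V) (p : V → V) (n : ℕ)
    (u : V) (g : V → V) :
    entranceMass P W r p (n + 1) u g =
      ∑ s, entranceMass P W r p n s (Function.update g u s) * M s u := by
  rw [entranceMass, ← sum_measureReal_inter_eq (hW.measurableSet_eq n)]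
  refine Finset.sum_congr rfl fun s _ => ?_
  rw [entranceMass, ← hW.measureReal_step n
    (Φ := fun w => w 0 = r ∧ ∀ v, v ≠ r → entranceMap w n (Function.update g u s) v = p v)
    (fun w w' h => by rw [h 0 n.zero_le, entranceMap_congr h])]
  have key : ∀ ω, W n ω = s → W (n + 1) ω = u →
      entranceMap (fun i => W i ω) (n + 1) g =
        entranceMap (fun i => W i ω) n (Function.update g u s) := by
    rintro ω rfl rfl
    exact entranceMap_succ _ _ _
  congr 1
  ext ω
  constructor
  · rintro ⟨⟨h, hu⟩, hs⟩
    rw [key ω hs hu] at h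
    exact ⟨⟨h, hs⟩, hu⟩
  · rintro ⟨⟨h, hs⟩, hu⟩
    rw [← key ω hs hu] at h
    exact ⟨⟨h, hu⟩, hs⟩

/-- The coupling identity: the stationary measure on rooted maps is preserved by one step of the
chain, since `reversal M ρ u s / ρ s = M s u / ρ u`. -/
theorem rootedAverage_entranceMass_succ (hE : (SimpleGraph.fromEdgeSet E).Connected)
    (hM : IsPositiveKernel E M) (hρ : IsInvariantDistribution M ρ)
    (hW : IsMarkovChain M P W) (r : V) (p : V → V) (n : ℕ) :
    rootedAverage (reversal M ρ) ρ (entranceMass P W r p (n + 1)) =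
      rootedAverage (reversal M ρ) ρ (entranceMass P W r p n) := by
  classical
  have hpos := invariant_pos hE hM hρ
  have hexp : rootedAverage (reversal M ρ) ρ (entranceMass P W r p n) =
      ∑ s, ∑ u, (ρ s)⁻¹ * (reversal M ρ u s * ∑ g, if IsRooted g u then
        weight (reversal M ρ) g * entranceMass P W r p n s (Function.update g u s) else 0) := by
    refine Finset.sum_congr rfl fun s _ => ?_
    rw [sum_rooted_eq (sum_reversal hE hM hρ), Finset.mul_sum]
  rw [hexp, Finset.sum_comm, rootedAverage]
  refine Finset.sum_congr rfl fun u _ => ?_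
  have h1 : ∀ s, (ρ s)⁻¹ * (reversal M ρ u s * ∑ g, if IsRooted g u then
      weight (reversal M ρ) g * entranceMass P W r p n s (Function.update g u s) else 0) =
      (ρ u)⁻¹ * ∑ g, if IsRooted g u then weight (reversal M ρ) g *
        (entranceMass P W r p n s (Function.update g u s) * M s u) else 0 := by
    intro s
    have hcoef : (ρ s)⁻¹ * reversal M ρ u s = (ρ u)⁻¹ * M s u := by
      simp only [reversal, Matrix.of_apply]
      have := (hpos s).ne'
      have := (hpos u).ne'
      field_simp
    rw [← mul_assoc, hcoef, mul_assoc, Finset.mul_sum]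
    congr 1
    refine Finset.sum_congr rfl fun g _ => ?_
    split_ifs
    · ring
    · simp
  rw [Finset.sum_congr rfl fun s _ => h1 s, ← Finset.mul_sum, Finset.sum_comm]
  congr 1
  refine Finset.sum_congr rfl fun g _ => ?_
  split_ifs
  · rw [← Finset.mul_sum, hW.entranceMass_succ]
  · simp

omit [IsProbabilityMeasure P] in
theorem rootedAverage_entranceMass_zero (hE : (SimpleGraph.fromEdgeSet E).Connected)
    (hM : IsPositiveKernel E M) (hρ : IsInvariantDistribution M ρ)
    {r : V} {p : V → V} (hp : IsRooted p r) :
    rootedAverage (reversal M ρ) ρ (entranceMass P W r p 0) =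
      P.real {ω | W 0 ω = r} * (∏ v ∈ Finset.univ.erase r, reversal M ρ v (p v)) / ρ r := by
  classical
  have hzero : ∀ s g, entranceMass P W r p 0 s g =
      if s = r then P.real {ω | W 0 ω = r} * (if ∀ v, v ≠ r → g v = p v then 1 else 0)
      else 0 := by
    intro s g
    rw [entranceMass]
    split_ifs with h1 h2
    · subst h1
      rw [mul_one]
      congr 1
      ext ω
      simp only [Set.mem_ofPred_eq]
      refine ⟨fun h => h.2, fun h => ⟨⟨h, fun v hv => ?_⟩, h⟩⟩
      rw [entranceMap_zero _ _ (by rwa [h]), h2 v hv]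
    · rw [mul_zero]
      convert measureReal_empty
      ext ω
      simp only [Set.mem_ofPred_eq, Set.mem_empty_iff_false, iff_false]
      rintro ⟨⟨h, h'⟩, -⟩
      refine h2 fun v hv => ?_
      rw [← h' v hv, entranceMap_zero _ _ (by rwa [h])]
    · convert measureReal_empty
      ext ω
      simp only [Set.mem_ofPred_eq, Set.mem_empty_iff_false, iff_false]
      rintro ⟨⟨h, -⟩, h'⟩
      exact h1 (h'.symm.trans h)
  rw [rootedAverage, Finset.sum_eq_single r]
  · rw [← sum_rooted_agree (sum_reversal hE hM hρ) hp, div_eq_inv_mul]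
    refine congrArg ((ρ r)⁻¹ * ·) ?_
    rw [Finset.mul_sum]
    refine (Finset.sum_congr rfl fun g _ => ?_)
    rw [hzero, if_pos rfl]
    by_cases h : IsRooted g r
    · rw [if_pos h, if_pos h]; ring
    · rw [if_neg h, if_neg h, mul_zero]
  · intro s _ hs
    simp [hzero, hs]
  · simp

/-- The average of `entranceMass` over rooted maps does not depend on `n`. At time `0` it is the
right hand side; once `V` is covered the completing map is irrelevant, so the limit is the left hand
side. -/
theorem measureReal_firstPred_eq (hE : (SimpleGraph.fromEdgeSet E).Connected)
    (hM : IsPositiveKernel E M) (hρ : IsInvariantDistribution M ρ)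
    (hW : IsMarkovChain M P W) {r : V} {p : V → V} (hp : IsRooted p r) :
    (∑ v, rootedWeight (reversal M ρ) v) *
      P.real {ω | Covers (fun n => W n ω) ∧
        W 0 ω = r ∧ ∀ v, v ≠ r → firstPred (fun n => W n ω) v = p v} =
      P.real {ω | W 0 ω = r} * (∏ v ∈ Finset.univ.erase r, reversal M ρ v (p v)) / ρ r := by
  set C := ∑ v, rootedWeight (reversal M ρ) v
  set T := {ω | Covers (fun n => W n ω) ∧
        W 0 ω = r ∧ ∀ v, v ≠ r → firstPred (fun n => W n ω) v = p v} with hT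
  have hpos := invariant_pos hE hM hρ
  have hconst : ∀ n, rootedAverage (reversal M ρ) ρ (entranceMass P W r p n) =
      P.real {ω | W 0 ω = r} * (∏ v ∈ Finset.univ.erase r, reversal M ρ v (p v)) / ρ r := by
    intro n
    induction n with
    | zero => exact rootedAverage_entranceMass_zero hE hM hρ hp
    | succ n ih => rw [rootedAverage_entranceMass_succ hE hM hρ hW, ih]
  let U : ℕ → Set Ω := fun n => {ω | (visited (fun i => W i ω) n).card ≠ Fintype.card V}
  have hU : Tendsto (fun n => C * P.real (U n)) atTop (𝓝 0) := by
    simpa using (hW.tendsto_notCovered hE hM hρ).const_mul C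
  have hsum : ∀ n (A : Set Ω), ∑ s, P.real {ω | ω ∈ A ∧ W n ω = s} = P.real A :=
    fun n A => sum_measureReal_inter_eq (hW.measurableSet_eq n) A
  -- Outside `U n` the completed tree is the first-entrance tree, whatever the completing map is.
  have hupper : ∀ n, rootedAverage (reversal M ρ) ρ (entranceMass P W r p n) ≤
      C * P.real T + C * P.real (U n) := by
    intro n
    refine (rootedAverage_mono (reversal_nonneg hE hM hρ) hpos (b := fun s _ =>
      P.real {ω | ω ∈ T ∧ W n ω = s} + P.real {ω | ω ∈ U n ∧ W n ω = s}) fun s g => ?_).trans ?_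
    · refine (measureReal_mono ?_).trans (measureReal_union_le _ _)
      rintro ω ⟨⟨h0, h⟩, hs⟩
      by_cases hc : ω ∈ U n
      · exact Or.inr ⟨hc, hs⟩
      · have hc' : (visited (fun i => W i ω) n).card = Fintype.card V := not_not.1 hc
        rw [entranceMap_of_card hc'] at h
        exact Or.inl ⟨⟨⟨n, hc'⟩, h0, h⟩, hs⟩
    · rw [rootedAverage_const hE hM hρ, Finset.sum_add_distrib, hsum, hsum, mul_add]
  have hlower : ∀ n, C * P.real T - C * P.real (U n) ≤
      rootedAverage (reversal M ρ) ρ (entranceMass P W r p n) := by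
    intro n
    refine le_trans ?_ (rootedAverage_mono (reversal_nonneg hE hM hρ) hpos (a := fun s _ =>
      P.real {ω | ω ∈ T ∧ W n ω = s} - P.real {ω | ω ∈ U n ∧ W n ω = s}) fun s g => ?_)
    · rw [rootedAverage_const hE hM hρ, Finset.sum_sub_distrib, hsum, hsum, mul_sub]
    · rw [sub_le_iff_le_add]
      refine (measureReal_mono ?_).trans (measureReal_union_le _ _)
      rintro ω ⟨⟨-, h0, h⟩, hs⟩
      by_cases hc : ω ∈ U n
      · exact Or.inr ⟨hc, hs⟩
      · have hc' : (visited (fun i => W i ω) n).card = Fintype.card V := not_not.1 hc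
        refine Or.inl ⟨⟨h0, ?_⟩, hs⟩
        rwa [entranceMap_of_card hc']
  refine le_antisymm ?_ ?_
  · refine le_of_tendsto' (by simpa using hU.const_sub (C * P.real T)) fun n => ?_
    rw [← hconst n]
    exact hlower n
  · refine ge_of_tendsto' (by simpa using hU.const_add (C * P.real T)) fun n => ?_
    rw [← hconst n]
    exact hupper n

end chain

end AldousBroder

theorem theorem2 {V : Type*} [Fintype V] [DecidableEq V]
    (E : Set (Sym2 V)) (hE : (SimpleGraph.fromEdgeSet E).Connected)
    (M : Matrix V V ℝ) (hM : AldousBroder.IsPositiveKernel E M)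
    (ρ : V → ℝ) (hρ : AldousBroder.IsInvariantDistribution M ρ) :
    ∃ c : ℝ, 0 < c ∧
      ∀ {Ω : Type*} [MeasurableSpace Ω] (P : MeasureTheory.Measure Ω)
        [MeasureTheory.IsProbabilityMeasure P] (W : ℕ → Ω → V),
        AldousBroder.IsMarkovChain M P W →
        (∀ᵐ ω ∂P, AldousBroder.Covers (fun n => W n ω)) ∧
        (∀ t : AldousBroder.RootedSpanningTree E, P {ω | W 0 ω = t.root} ≠ 0 →
          (ProbabilityTheory.cond P {ω | W 0 ω = t.root}).real (AldousBroder.treeEvent W t)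
            = c * (∏ e ∈ t.edges, AldousBroder.reversal M ρ e.1 e.2) / ρ t.root) ∧
        ((∀ v, P.real {ω | W 0 ω = v} = ρ v) →
          ∀ t : AldousBroder.RootedSpanningTree E,
            P.real (AldousBroder.treeEvent W t)
              = c * ∏ e ∈ t.edges, AldousBroder.reversal M ρ e.1 e.2) := by
  classical
  have hC := AldousBroder.sum_rootedWeight_pos hE (AldousBroder.reversal_nonneg hE hM hρ)
    (AldousBroder.sum_reversal hE hM hρ) (AldousBroder.reversal_pos hE hM hρ)
  set C := ∑ v, AldousBroder.rootedWeight (AldousBroder.reversal M ρ) v with hCdef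
  refine ⟨C⁻¹, inv_pos.2 hC, fun {Ω} _ P _ W hW => ?_⟩
  have htree : ∀ t : AldousBroder.RootedSpanningTree E,
      AldousBroder.treeEvent W t ⊆ {ω | W 0 ω = t.root} ∧
      P.real (AldousBroder.treeEvent W t) = P.real {ω | W 0 ω = t.root} *
        (C⁻¹ * (∏ e ∈ t.edges, AldousBroder.reversal M ρ e.1 e.2) / ρ t.root) := by
    intro t
    obtain ⟨p, hp, hedges⟩ := t.exists_parentMap
    have hset : AldousBroder.treeEvent W t = {ω | AldousBroder.Covers (fun n => W n ω) ∧
        W 0 ω = t.root ∧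
          ∀ v, v ≠ t.root → AldousBroder.firstPred (fun n => W n ω) v = p v} := by
      ext ω
      exact and_congr_right fun hcov => AldousBroder.firstEntranceTree_eq_iff hedges hcov
    refine ⟨hset ▸ fun ω h => h.2.1, ?_⟩
    have hmain := AldousBroder.measureReal_firstPred_eq hE hM hρ hW hp
    rw [← hset, ← hCdef] at hmain
    rw [hedges, Finset.prod_image fun a _ b _ h => congrArg Prod.fst h]
    rw [← inv_mul_cancel_left₀ hC.ne' (P.real (AldousBroder.treeEvent W t)), hmain]
    ring
  refine ⟨hW.ae_covers hE hM hρ, fun t ht => ?_, fun hlaw t => ?_⟩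
  · rw [MeasureTheory.measureReal_def,
      ProbabilityTheory.cond_apply (hW.measurableSet_eq 0 t.root),
      Set.inter_eq_self_of_subset_right (htree t).1, ENNReal.toReal_mul, ENNReal.toReal_inv,
      ← MeasureTheory.measureReal_def, ← MeasureTheory.measureReal_def, (htree t).2,
      inv_mul_cancel_left₀]
    rwa [Ne, MeasureTheory.measureReal_eq_zero_iff]
  · rw [(htree t).2, hlaw, mul_div_cancel₀ _ (AldousBroder.invariant_pos hE hM hρ t.root).ne']
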